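/- Let $d,\chi,N,D$ be natural numbers and let $A=(A^i)_{i=1}^d$ be a tuple of complex $\chi\times\chi$ matrices that is a \emph{normal tensor}: the $A^i$ have no non-trivial common invariant subspace, and the completely positive map $X\mapsto\sum_i A^iX(A^i)^\dagger$ has a unique largest eigenvalue, equal to one (that is, $1$ is an algebraically simple eigenvalue and all other eigenvalues have modulus strictly less than $1$). Let $$|\psi\rangle=\sum_{i_1,\dots,i_N=1}^d \operatorname{Tr}[A^{i_1}A^{i_2}\cdots A^{i_N}]\,|i_1\dots i_N\rangle\in(\mathbb C^d)^{\otimes N}$$ be the associated translationally invariant MPS. Let $L_I$ be the injectivity length of $A$, i.e. the least $L\ge 1$ such that the map $X\mapsto\sum_{i_1,\dots,i_L}\operatorname{Tr}[XA^{i_1}\cdots A^{i_L}]\,|i_1\dots i_L\rangle$ on $\mathcal M_\chi(\mathbb C)$ is injective. Say that a vector in $(\mathbb C^d)^{\otimes N}$ is an MPS-up$_{\varepsilon,D}$ if for every permutation $\pi$ of the $N$ particles, with $U_\pi$ the unitary permuting the tensor factors according to $\pi$, the image of the vector under $U_\pi$ is at norm distance at most $\varepsilon$ from an MPS $$\sum_{i_1,\dots,i_N}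 A_\pi^{[1],i_1}A_\pi^{[2],i_2}\cdots A_\pi^{[N],i_N}\,|i_1\dots i_N\rangle$$ with open boundary conditions, where $A_\pi^{[n],i}$ is a $D_\pi^{[n]}\times D_\pi^{[n+1]}$ matrix, $D_\pi^{[n]}\le D$ for all $n$ and $D_\pi^{[1]}=D_\pi^{[N+1]}=1$. (For $\varepsilon=0$ and $D\ge 1$ this says that the Schmidt rank across every bipartition of the particles is at most $D$.) If $|\psi\rangle$ is an MPS-up$_{0,D}$ and $N>L_I(\log_2 D+1)$, then $|\psi\rangle$ is a product state: there is a non-zero $|\phi\rangle\in\mathbb C^d$ with $|\psi\rangle=|\phi\rangle^{\otimes N}$. -/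

import Mathlib

namespace MPSUp

/-- The `N`-particle space `(ℂ^d)^{⊗N}`, with its Hilbert norm: the vector `ψ` is given by its
amplitudes `ψ i` in the computational basis `|i_1 … i_N⟩`. -/
abbrev State (N d : ℕ) : Type := EuclideanSpace ℂ (Fin N → Fin d)

/-- Blocking `L` sites of a site tensor: `(i_1, …, i_L) ↦ A^{i_1} A^{i_2} ⋯ A^{i_L}`. -/
def block {d χ : ℕ} (A : Fin d → Matrix (Fin χ) (Fin χ) ℂ) (L : ℕ) :
    (Fin L → Fin d) → Matrix (Fin χ) (Fin χ) ℂ :=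
  fun i => (List.ofFn fun n => A (i n)).prod

/-- The translationally invariant MPS `∑ Tr[A^{i_1} ⋯ A^{i_N}] |i_1 … i_N⟩`. -/
noncomputable def tiMPS {d χ : ℕ} (A : Fin d → Matrix (Fin χ) (Fin χ) ℂ) (N : ℕ) : State N d :=
  WithLp.toLp 2 fun i => (block A N i).trace

/-- The completely positive map `X ↦ ∑ i, A^i X (A^i)†` of a site tensor. -/
noncomputable def transferMap {d χ : ℕ} (A : Fin d → Matrix (Fin χ) (Fin χ) ℂ) :
    Matrix (Fin χ) (Fin χ) ℂ →ₗ[ℂ] Matrix (Fin χ) (Fin χ) ℂ :=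
  ∑ i, LinearMap.mulLeft ℂ (A i) ∘ₗ LinearMap.mulRight ℂ (A i).conjTranspose

/-- A tensor is normal if its matrices have no non-trivial common invariant subspace and its
completely positive map has a unique largest eigenvalue, equal to one: among the eigenvalues,
counted with algebraic multiplicity, exactly one has modulus at least one, and it is `1`. -/
structure IsNormalTensor {d χ : ℕ} (A : Fin d → Matrix (Fin χ) (Fin χ) ℂ) : Prop where
  irreducible : ∀ V : Submodule ℂ (Fin χ → ℂ),
    (∀ i, ∀ v ∈ V, (A i).mulVec v ∈ V) → V = ⊥ ∨ V = ⊤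
  peripheral : (transferMap A).charpoly.roots.filter (fun μ => 1 ≤ ‖μ‖) = {1}

/-- A tensor is injective if the map `X ↦ ∑ i, Tr[X A^i] |i⟩` is injective. -/
def IsInjectiveTensor {ι : Type} {χ : ℕ} (A : ι → Matrix (Fin χ) (Fin χ) ℂ) : Prop :=
  Function.Injective fun (X : Matrix (Fin χ) (Fin χ) ℂ) (i : ι) => (X * A i).trace

/-- The injectivity length: the least number `L ≥ 1` of sites such that the tensor obtained by
blocking `L` sites is injective. -/
noncomputable def injectivityLength {d χ : ℕ} (A : Fin d → Matrix (Fin χ) (Fin χ) ℂ) : ℕ :=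
  sInf {L : ℕ | 0 < L ∧ IsInjectiveTensor (block A L)}

/-- The unitary `U_π` permuting the `N` tensor factors, `U_π |i⟩ = |i ∘ π⁻¹⟩`: the particle at
position `n` is moved to position `π n`. -/
def permuteSites {N d : ℕ} (π : Equiv.Perm (Fin N)) (ψ : State N d) : State N d :=
  WithLp.toLp 2 fun i => ψ (i ∘ π)

/-- The (not necessarily translationally invariant) MPS with bond dimensions `b 0, …, b N` and
site tensors `A n : Fin d → ℂ^{b n × b (n+1)}`. The matrix product is written out as a sum over the
bond indices; for open boundaries, `b 0 = b N = 1`, it is the `1 × 1` matrix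
`A^{[1],i_1} ⋯ A^{[N],i_N}`, that is, its trace. -/
noncomputable def openMPS {N d : ℕ} (b : Fin (N + 1) → ℕ)
    (A : (n : Fin N) → Fin d → Matrix (Fin (b n.castSucc)) (Fin (b n.succ)) ℂ) : State N d :=
  WithLp.toLp 2 fun i =>
    ∑ α : (n : Fin (N + 1)) → Fin (b n), ∏ n : Fin N, A n (i n) (α n.castSucc) (α n.succ)

/-- The property MPS-up`_{ε,D}`: after every permutation of the particles, the state is `ε`-close
to an MPS with open boundaries and all bond dimensions at most `D`. -/
def IsMPSUp {N d : ℕ} (ε : ℝ) (D : ℕ) (ψ : State N d) : Prop :=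
  ∀ π : Equiv.Perm (Fin N),
    ∃ (b : Fin (N + 1) → ℕ)
      (A : (n : Fin N) → Fin d → Matrix (Fin (b n.castSucc)) (Fin (b n.succ)) ℂ),
      b 0 = 1 ∧ b (Fin.last N) = 1 ∧ (∀ n, b n ≤ D) ∧
        ‖permuteSites π ψ - openMPS b A‖ ≤ ε

/-- The product vector `|φ⟩^{⊗N}`. -/
noncomputable def productState {d : ℕ} (φ : EuclideanSpace ℂ (Fin d)) (N : ℕ) : State N d :=
  WithLp.toLp 2 fun i => ∏ n, φ (i n)

end MPSUp

open Filter Topology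

namespace MPSUp

/-! If `χ = 1`, the trace is a product of scalars and the state is visibly a product. If `χ ≥ 2`, a
bipartition of Schmidt rank larger than `D` is exhibited. Let `L` be the injectivity length and
write `N = (2m+1)L + t` with `0 < t ≤ 2L`. One party receives the even-numbered blocks of length
`L`, the other the odd-numbered blocks and the tail. By injectivity, suitable weights turn each
block into any chosen matrix unit, so every one of the `2m` bonds between consecutive blocks
contributes a factor `χ`. The tail contributes `χ²` if `t ≥ L`, and at least `2` if `t < L`. Hence
`log₂ D` is at least `2m+2`, respectively `2m+1`, against the lower bound on `N`. The rank estimate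
is `bond_pow_mul_card_le`.

The injectivity length must also be attained (`exists_isInjectiveTensor_block`). The powers of the
transfer map converge to a non-zero operator. If no block were injective, compactness would give a
non-zero matrix whose word forms tend to zero. Such matrices form a two-sided ideal, by Burnside the
whole matrix algebra, and this forces the limit operator to vanish. -/

/-! ### Irreducible algebras and convergence of powers -/

/-- **Burnside's theorem**: an irreducible algebra of operators on a finite-dimensional complex
space contains every operator. -/
theorem subalgebra_eq_top_of_irreducible {V : Type*} [AddCommGroup V] [Module ℂ V]
    [FiniteDimensional ℂ V] [Nontrivial V] (S : Subalgebra ℂ (Module.End ℂ V))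
    (h : ∀ W : Submodule ℂ V, (∀ a ∈ S, ∀ w ∈ W, a w ∈ W) → W = ⊥ ∨ W = ⊤) : S = ⊤ := by
  have hsub : ∀ W : Submodule S V, W = ⊥ ∨ W = ⊤ := by
    intro W
    let W' : Submodule ℂ V :=
      { carrier := W
        add_mem' := W.add_mem
        zero_mem' := W.zero_mem
        smul_mem' := fun c x hx => by
          have := W.smul_mem (algebraMap ℂ S c) hx
          simpa using this }
    rcases h W' (fun a ha w hw => W.smul_mem (⟨a, ha⟩ : S) hw) with h0 | h0
    · left
      ext x
      change x ∈ W' ↔ _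
      simp [h0]
    · right
      ext x
      change x ∈ W' ↔ _
      simp [h0]
  have : IsSimpleModule S V := by
    rw [isSimpleModule_iff]
    exact { exists_pair_ne := ⟨⊥, ⊤, bot_ne_top⟩, eq_bot_or_eq_top := hsub }
  -- Schur's lemma: an eigenspace of an `S`-linear map is `S`-invariant. So every linear `g`
  -- commutes with `End_S V`, and Jacobson density applies to it.
  have hscalar : ∀ φ : Module.End S V, ∃ c : ℂ, ∀ x, φ x = c • x := by
    intro φ
    let φ' : Module.End ℂ V :=
      { toFun := φ
        map_add' := φ.map_add
        map_smul' := fun c x => by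
          simp }
    obtain ⟨c, hc⟩ := Module.End.exists_eigenvalue φ'
    refine ⟨c, ?_⟩
    have hinv : ∀ a ∈ S, ∀ w ∈ φ'.eigenspace c, a w ∈ φ'.eigenspace c := by
      intro a ha w hw
      rw [Module.End.mem_eigenspace_iff] at hw ⊢
      have h1 : φ (a w) = a (φ w) := φ.map_smul (⟨a, ha⟩ : S) w
      change φ (a w) = _
      change φ w = _ at hw
      rw [h1, hw, map_smul]
    rcases h _ hinv with h0 | h0
    · exact absurd h0 hc
    · intro x
      have : x ∈ φ'.eigenspace c := by rw [h0]; trivial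
      exact Module.End.mem_eigenspace_iff.1 this
  rw [eq_top_iff]
  intro g _
  let g' : Module.End (Module.End S V) V :=
    { toFun := g
      map_add' := g.map_add
      map_smul' := fun φ x => by
        obtain ⟨c, hc⟩ := hscalar φ
        simp [hc] }
  obtain ⟨s, hs⟩ := Module.Finite.fg_top (R := ℂ) (M := V)
  obtain ⟨r, hr⟩ := jacobson_density g' s
  have : g = r.1 := LinearMap.ext_on hs (fun m hm => hr m hm)
  rw [this]
  exact r.2

theorem tendsto_pow_zero_of_spectrum {B : Type*} [NormedRing B] [NormedAlgebra ℂ B]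
    [CompleteSpace B] [Nontrivial B] (a : B) (ha : ∀ z ∈ spectrum ℂ a, ‖z‖ < 1) :
    Tendsto (fun n : ℕ => a ^ n) atTop (𝓝 0) := by
  have h1 : spectralRadius ℂ a < (1 : NNReal) :=
    spectrum.spectralRadius_lt_of_forall_lt a fun z hz => by
      have := ha z hz
      exact_mod_cast this
  obtain ⟨r, hr0, hr1⟩ := ENNReal.lt_iff_exists_nnreal_btwn.1 h1
  -- Gelfand's formula: eventually `‖a ^ n‖ ≤ r ^ n` with `r < 1`.
  have hev := (spectrum.pow_nnnorm_pow_one_div_tendsto_nhds_spectralRadius a).eventually_lt_const hr0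
  rw [tendsto_zero_iff_norm_tendsto_zero]
  have hr1' : (r : ℝ) < 1 := by exact_mod_cast hr1
  refine squeeze_zero' (Eventually.of_forall fun n => norm_nonneg _) ?_
    (tendsto_pow_atTop_nhds_zero_of_lt_one r.2 hr1')
  filter_upwards [hev, eventually_gt_atTop 0] with n hn hn0
  have hn0' : (n : ℝ) ≠ 0 := by positivity
  have h2 := ENNReal.rpow_le_rpow hn.le (Nat.cast_nonneg (α := ℝ) n)
  rw [← ENNReal.rpow_mul, one_div_mul_cancel hn0', ENNReal.rpow_one, ENNReal.rpow_natCast] at h2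
  exact_mod_cast h2

attribute [local instance] Matrix.linftyOpNormedRing Matrix.linftyOpNormedAlgebra in
theorem tendsto_pow_apply_zero {V : Type*} [AddCommGroup V] [Module ℂ V]
    [FiniteDimensional ℂ V] [Nontrivial V] (F : Module.End ℂ V)
    (hF : ∀ z, F.HasEigenvalue z → ‖z‖ < 1) (f : V →ₗ[ℂ] ℂ) (v : V) :
    Tendsto (fun n : ℕ => f ((F ^ n) v)) atTop (𝓝 0) := by
  classical
  let b := Module.finBasis ℂ V
  have : Nonempty (Fin (Module.finrank ℂ V)) := ⟨⟨0, Module.finrank_pos⟩⟩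
  let e := LinearMap.toMatrixAlgEquiv b
  have h := tendsto_pow_zero_of_spectrum (e F) (fun z hz => by
    rw [AlgEquiv.spectrum_eq, ← Module.End.hasEigenvalue_iff_mem_spectrum] at hz
    exact hF z hz)
  let g : Matrix (Fin (Module.finrank ℂ V)) (Fin (Module.finrank ℂ V)) ℂ →ₗ[ℂ] ℂ :=
    f ∘ₗ (LinearMap.applyₗ v) ∘ₗ e.symm.toLinearMap
  have hg : Continuous g := g.continuous_of_finiteDimensional
  have := (hg.tendsto 0).comp h
  rw [map_zero] at this
  refine this.congr fun n => ?_
  simp [g, ← map_pow]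

/-- If `1` is a simple root of the characteristic polynomial and all other roots lie in the open
unit disc, then the powers converge to a non-zero operator. -/
theorem exists_tendsto_pow_of_peripheral {V : Type*} [AddCommGroup V] [Module ℂ V]
    [FiniteDimensional ℂ V] (T : Module.End ℂ V)
    (hT : T.charpoly.roots.filter (fun μ => 1 ≤ ‖μ‖) = {1}) :
    ∃ R : Module.End ℂ V, R ≠ 0 ∧ ∀ (f : V →ₗ[ℂ] ℂ) (v : V),
      Tendsto (fun n : ℕ => f ((T ^ n) v)) atTop (𝓝 (f (R v))) := by
  have hp0 : T.charpoly ≠ 0 := (LinearMap.charpoly_monic T).ne_zero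
  have hmem : ∀ μ, T.HasEigenvalue μ → 1 ≤ ‖μ‖ → μ = 1 := by
    intro μ hμ h1
    have : μ ∈ T.charpoly.roots.filter (fun μ => 1 ≤ ‖μ‖) := by
      rw [Multiset.mem_filter, Polynomial.mem_roots hp0]
      exact ⟨(Module.End.hasEigenvalue_iff_isRoot_charpoly T μ).1 hμ, h1⟩
    rw [hT] at this
    simpa using this
  have hone : T.charpoly.rootMultiplicity 1 = 1 := by
    rw [← Polynomial.count_roots,
      ← Multiset.count_filter_of_pos (p := fun μ : ℂ => 1 ≤ ‖μ‖) (by simp), hT]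
    simp
  obtain ⟨q, hq, hq1⟩ := Polynomial.exists_eq_pow_rootMultiplicity_mul_and_not_dvd
    T.charpoly hp0 1
  rw [hone, pow_one] at hq
  rw [Polynomial.dvd_iff_isRoot, Polynomial.IsRoot.def] at hq1
  -- With `charpoly = (X - 1) q` and `q(1) ≠ 0`, this is the spectral projection onto the eigenvalue
  -- `1`.
  let R : Module.End ℂ V := (q.eval 1)⁻¹ • Polynomial.aeval T q
  have hTR : T * R = R := by
    have h0 := LinearMap.aeval_self_charpoly T
    rw [hq, map_mul] at h0
    simp only [map_sub, Polynomial.aeval_X, map_one] at h0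
    have h1 : (T - 1) * R = 0 := by
      simp only [R, mul_smul_comm]
      rw [h0, smul_zero]
    rw [sub_mul, one_mul, sub_eq_zero] at h1
    exact h1
  have hRT : R * T = R := by
    have : R * T = T * R := by
      simp only [R, mul_smul_comm, smul_mul_assoc]
      congr 1
      have : Polynomial.aeval T (q * Polynomial.X) = Polynomial.aeval T (Polynomial.X * q) := by
        rw [mul_comm]
      simpa only [map_mul, Polynomial.aeval_X] using this
    rw [this, hTR]
  have hfix : ∀ v, T v = v → R v = v := by
    intro v hv
    have : ∀ p : Polynomial ℂ, Polynomial.aeval T p v = p.eval 1 • v := by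
      intro p
      induction p using Polynomial.induction_on' with
      | add p q hp hq => simp [hp, hq, add_smul]
      | monomial n a =>
        have hn : (T ^ n) v = v := by
          induction n with
          | zero => simp
          | succ n ih => rw [pow_succ, Module.End.mul_apply, hv, ih]
        simp [Polynomial.aeval_monomial, hn]
    simp [R, this, smul_smul, inv_mul_cancel₀ hq1]
  obtain ⟨v₀, hv₀⟩ : ∃ v, T.HasEigenvector 1 v := by
    apply Module.End.HasEigenvalue.exists_hasEigenvector
    rw [Module.End.hasEigenvalue_iff_isRoot_charpoly, hq]
    simp
  have hv₀T : T v₀ = v₀ := by simpa using hv₀.apply_eq_smul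
  have : Nontrivial V := ⟨v₀, 0, hv₀.2⟩
  have hTnR : ∀ n : ℕ, T ^ n * R = R := by
    intro n
    induction n with
    | zero => simp
    | succ n ih => rw [pow_succ, mul_assoc, hTR, ih]
  have hRR : R * R = R := by
    ext v
    exact hfix _ (congrArg (fun g : Module.End ℂ V => g v) hTR)
  have hF : ∀ n : ℕ, (T - R) ^ (n + 1) = T ^ (n + 1) - R := by
    intro n
    induction n with
    | zero => simp
    | succ n ih =>
      rw [pow_succ, ih, sub_mul, mul_sub, mul_sub, hTnR, hRT, hRR, ← pow_succ, sub_self, sub_zero]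
  refine ⟨R, fun h => hv₀.2 ?_, fun f v => ?_⟩
  · rw [← hfix v₀ hv₀T, h]; rfl
  -- An eigenvector `w` of `T - R` with `‖z‖ ≥ 1` has `R w = 0`, so it is an eigenvector of `T` and
  -- `z = 1`. But then `R w = w`.
  · have h0 := tendsto_pow_apply_zero (T - R) (fun z hz => by
      by_contra! hz1
      obtain ⟨w, hw⟩ := hz.exists_hasEigenvector
      have hw1 : T w - R w = z • w := hw.apply_eq_smul
      have hz0 : z ≠ 0 := by rintro rfl; norm_num at hz1
      have hRw : R w = 0 := by
        have h2 : R (T w) = R w := congrArg (fun g : Module.End ℂ V => g w) hRT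
        have h3 : R (R w) = R w := congrArg (fun g : Module.End ℂ V => g w) hRR
        have := congrArg R hw1
        rw [map_sub, h2, h3, sub_self, map_smul] at this
        exact (smul_eq_zero.1 this.symm).resolve_left hz0
      rw [hRw, sub_zero] at hw1
      have hz' : z = 1 := hmem z (Module.End.hasEigenvalue_of_hasEigenvector
        ⟨Module.End.mem_eigenspace_iff.2 hw1, hw.2⟩) hz1
      rw [hz', one_smul] at hw1
      exact hw.2 (by rw [← hfix w hw1, hRw])) f v
    rw [← tendsto_add_atTop_iff_nat 1]
    have h1 := ((tendsto_add_atTop_iff_nat 1).2 h0).add_const (f (R v))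
    rw [zero_add] at h1
    refine h1.congr fun n => ?_
    rw [hF]
    simp

/-! ### Some block of a normal tensor is injective -/

section Wielandt

variable {d χ : ℕ} (A : Fin d → Matrix (Fin χ) (Fin χ) ℂ)

theorem block_cons (n : ℕ) (i : Fin d) (w : Fin n → Fin d) :
    block A (n + 1) (Fin.cons i w : Fin (n + 1) → Fin d) = A i * block A n w := by
  simp [block, List.ofFn_succ]

theorem block_snoc (n : ℕ) (i : Fin d) (w : Fin n → Fin d) :
    block A (n + 1) (Fin.snoc w i : Fin (n + 1) → Fin d) = block A n w * A i := by
  rw [block, List.ofFn_succ_last]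
  simp [block]

theorem sum_words_cons {M : Type*} [AddCommMonoid M] (n : ℕ) (f : (Fin (n + 1) → Fin d) → M) :
    ∑ w, f w = ∑ i, ∑ w : Fin n → Fin d, f (Fin.cons i w : Fin (n + 1) → Fin d) := by
  rw [← (Fin.consEquiv (fun _ => Fin d)).sum_comp, Fintype.sum_prod_type]
  rfl

theorem sum_words_snoc {M : Type*} [AddCommMonoid M] (n : ℕ) (f : (Fin (n + 1) → Fin d) → M) :
    ∑ w, f w = ∑ i, ∑ w : Fin n → Fin d, f (Fin.snoc w i : Fin (n + 1) → Fin d) := by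
  rw [← (Fin.snocEquiv (fun _ => Fin d)).sum_comp, Fintype.sum_prod_type]
  rfl

theorem transferMap_apply (X : Matrix (Fin χ) (Fin χ) ℂ) :
    transferMap A X = ∑ i, A i * X * (A i).conjTranspose := by
  simp [transferMap, LinearMap.sum_apply, mul_assoc]

theorem transferMap_pow_apply (n : ℕ) (X : Matrix (Fin χ) (Fin χ) ℂ) :
    (transferMap A ^ n) X = ∑ w, block A n w * X * (block A n w).conjTranspose := by
  induction n with
  | zero => simp [block]
  | succ n ih =>
    rw [pow_succ', Module.End.mul_apply, ih, transferMap_apply, sum_words_cons]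
    refine Finset.sum_congr rfl fun i _ => ?_
    simp only [Finset.mul_sum, Finset.sum_mul, block_cons, Matrix.conjTranspose_mul, mul_assoc]

/-- The squared norm of the image of `X` under the map `X ↦ ∑ Tr[X A^{i_1} ⋯ A^{i_n}] |i⟩`. -/
noncomputable def wordForm (n : ℕ) (X : Matrix (Fin χ) (Fin χ) ℂ) : ℝ :=
  ∑ w, ‖(X * block A n w).trace‖ ^ 2

theorem wordForm_nonneg (n : ℕ) (X : Matrix (Fin χ) (Fin χ) ℂ) : 0 ≤ wordForm A n X :=
  Finset.sum_nonneg fun _ _ => by positivity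

theorem wordForm_mul_right_le (n : ℕ) (X : Matrix (Fin χ) (Fin χ) ℂ) (i : Fin d) :
    wordForm A n (X * A i) ≤ wordForm A (n + 1) X := by
  rw [wordForm, wordForm, sum_words_cons]
  simp only [block_cons, ← mul_assoc]
  exact Finset.single_le_sum (f := fun i => ∑ w, ‖(X * A i * block A n w).trace‖ ^ 2)
    (fun _ _ => Finset.sum_nonneg fun _ _ => by positivity) (Finset.mem_univ i)

/-- By cyclicity of the trace, the left factor `A i` becomes the last letter of a longer word; the
words ending in other letters only add non-negative terms. -/
theorem wordForm_mul_left_le (n : ℕ) (X : Matrix (Fin χ) (Fin χ) ℂ) (i : Fin d) :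
    wordForm A n (A i * X) ≤ wordForm A (n + 1) X := by
  rw [wordForm, wordForm, sum_words_snoc]
  have h : ∀ j w, (X * block A (n + 1) (Fin.snoc w j : Fin (n + 1) → Fin d)).trace
      = (A j * X * block A n w).trace := fun j w => by
    rw [block_snoc, ← mul_assoc, Matrix.trace_mul_comm, mul_assoc]
  simp only [h]
  exact Finset.single_le_sum (f := fun i => ∑ w, ‖(A i * X * block A n w).trace‖ ^ 2)
    (fun _ _ => Finset.sum_nonneg fun _ _ => by positivity) (Finset.mem_univ i)

theorem wordForm_add_le (n : ℕ) (X Y : Matrix (Fin χ) (Fin χ) ℂ) :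
    wordForm A n (X + Y) ≤ 2 * wordForm A n X + 2 * wordForm A n Y := by
  simp only [wordForm, Finset.mul_sum, ← Finset.sum_add_distrib]
  refine Finset.sum_le_sum fun w _ => ?_
  rw [add_mul, Matrix.trace_add]
  have h := norm_add_le (X * block A n w).trace (Y * block A n w).trace
  nlinarith [sq_nonneg (‖(X * block A n w).trace‖ - ‖(Y * block A n w).trace‖),
    norm_nonneg ((X * block A n w).trace + (Y * block A n w).trace)]

theorem wordForm_smul (n : ℕ) (c : ℂ) (X : Matrix (Fin χ) (Fin χ) ℂ) :
    wordForm A n (c • X) = ‖c‖ ^ 2 * wordForm A n X := by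
  simp [wordForm, Finset.mul_sum, mul_pow]

/-- The matrices on which the word forms tend to zero. -/
noncomputable def vanishing : Submodule ℂ (Matrix (Fin χ) (Fin χ) ℂ) where
  carrier := {X | Tendsto (fun n => wordForm A n X) atTop (𝓝 0)}
  zero_mem' := by simp [wordForm]
  add_mem' := fun {X Y} hX hY => by
    have h := (hX.const_mul 2).add (hY.const_mul 2)
    rw [mul_zero, add_zero] at h
    exact squeeze_zero (fun n => wordForm_nonneg A n _) (fun n => wordForm_add_le A n X Y) h
  smul_mem' := fun c X hX => by
    have h := hX.const_mul (‖c‖ ^ 2)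
    rw [mul_zero] at h
    simpa only [Set.mem_ofPred_eq, wordForm_smul] using h

variable {A}

theorem mem_vanishing {X : Matrix (Fin χ) (Fin χ) ℂ} :
    X ∈ vanishing A ↔ Tendsto (fun n => wordForm A n X) atTop (𝓝 0) := Iff.rfl

theorem mul_mem_vanishing {X : Matrix (Fin χ) (Fin χ) ℂ} (hX : X ∈ vanishing A) (i : Fin d) :
    A i * X ∈ vanishing A :=
  squeeze_zero (fun n => wordForm_nonneg A n _) (fun n => wordForm_mul_left_le A n X i)
    ((tendsto_add_atTop_iff_nat 1).2 (mem_vanishing.1 hX))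

theorem mul_mem_vanishing' {X : Matrix (Fin χ) (Fin χ) ℂ} (hX : X ∈ vanishing A) (i : Fin d) :
    X * A i ∈ vanishing A :=
  squeeze_zero (fun n => wordForm_nonneg A n _) (fun n => wordForm_mul_right_le A n X i)
    ((tendsto_add_atTop_iff_nat 1).2 (mem_vanishing.1 hX))

theorem adjoin_eq_top_of_irreducible (hχ : 0 < χ)
    (h : ∀ V : Submodule ℂ (Fin χ → ℂ), (∀ i, ∀ v ∈ V, (A i).mulVec v ∈ V) → V = ⊥ ∨ V = ⊤) :
    Algebra.adjoin ℂ (Set.range A) = ⊤ := by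
  have : Nonempty (Fin χ) := ⟨⟨0, hχ⟩⟩
  let e := (Matrix.toLinAlgEquiv' : Matrix (Fin χ) (Fin χ) ℂ ≃ₐ[ℂ] _)
  have h1 := subalgebra_eq_top_of_irreducible
    ((Algebra.adjoin ℂ (Set.range A)).map e.toAlgHom) (fun W hW => h W fun i v hv => by
      have := hW (e (A i)) ⟨A i, Algebra.subset_adjoin ⟨i, rfl⟩, rfl⟩ v hv
      simpa [e, Matrix.toLinAlgEquiv'_apply] using this)
  rw [eq_top_iff]
  intro M _
  have : e M ∈ (Algebra.adjoin ℂ (Set.range A)).map e.toAlgHom := by rw [h1]; trivial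
  obtain ⟨M', hM', he⟩ := this
  have : M' = M := e.injective he
  exact this ▸ hM'

theorem mul_mul_mem_of_adjoin_eq_top {Z : Submodule ℂ (Matrix (Fin χ) (Fin χ) ℂ)}
    (hl : ∀ i, ∀ X ∈ Z, A i * X ∈ Z) (hr : ∀ i, ∀ X ∈ Z, X * A i ∈ Z)
    (htop : Algebra.adjoin ℂ (Set.range A) = ⊤) (M M' : Matrix (Fin χ) (Fin χ) ℂ) :
    ∀ X ∈ Z, M * X * M' ∈ Z := by
  have h1 : ∀ X ∈ Z, M * X ∈ Z := by
    have hM : M ∈ Algebra.adjoin ℂ (Set.range A) := by rw [htop]; trivial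
    induction hM using Algebra.adjoin_induction with
    | mem x hx => obtain ⟨i, rfl⟩ := hx; exact hl i
    | algebraMap r => intro X hX; simpa [Algebra.algebraMap_eq_smul_one] using Z.smul_mem r hX
    | add x y _ _ hx hy => intro X hX; rw [add_mul]; exact Z.add_mem (hx X hX) (hy X hX)
    | mul x y _ _ hx hy => intro X hX; rw [mul_assoc]; exact hx _ (hy X hX)
  have h2 : ∀ X ∈ Z, X * M' ∈ Z := by
    have hM : M' ∈ Algebra.adjoin ℂ (Set.range A) := by rw [htop]; trivial
    induction hM using Algebra.adjoin_induction with
    | mem x hx => obtain ⟨i, rfl⟩ := hx; exact hr i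
    | algebraMap r => intro X hX; simpa [Algebra.algebraMap_eq_smul_one] using Z.smul_mem r hX
    | add x y _ _ hx hy => intro X hX; rw [mul_add]; exact Z.add_mem (hx X hX) (hy X hX)
    | mul x y _ _ hx hy => intro X hX; rw [← mul_assoc]; exact hy _ (hx X hX)
  exact fun X hX => h2 _ (h1 X hX)

theorem eq_top_of_ne_bot_of_two_sided {Z : Submodule ℂ (Matrix (Fin χ) (Fin χ) ℂ)}
    (h : ∀ M M', ∀ X ∈ Z, M * X * M' ∈ Z) (hZ : Z ≠ ⊥) : Z = ⊤ := by
  obtain ⟨X, hX, hX0⟩ := Z.exists_mem_ne_zero_of_ne_bot hZ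
  obtain ⟨a, b, hab⟩ : ∃ a b, X a b ≠ 0 := by
    by_contra! hc
    exact hX0 (by ext a b; exact hc a b)
  rw [eq_top_iff]
  intro Y _
  rw [Matrix.matrix_eq_sum_single Y]
  refine Z.sum_mem fun i _ => Z.sum_mem fun j _ => ?_
  have := h (Matrix.single i a (Y i j * (X a b)⁻¹)) (Matrix.single b j 1) X hX
  rw [Matrix.single_mul_mul_single] at this
  simpa [hab] using this

variable (A) in
theorem transferMap_pow_single (n : ℕ) (a b c e : Fin χ) :
    (transferMap A ^ n) (Matrix.single a c 1) b e
      = ∑ w, block A n w b a * star (block A n w e c) := by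
  rw [transferMap_pow_apply, Matrix.sum_apply]
  refine Finset.sum_congr rfl fun w _ => ?_
  rw [Matrix.mul_assoc, Matrix.mul_apply, Finset.sum_eq_single a]
  · simp [Matrix.single_mul_apply_same]
  · intro k _ hk
    simp [Matrix.single_mul_apply_of_ne, hk]
  · simp

-- The word form is a quadratic form whose coefficients are entries of the `n`-th power of the
-- transfer map, so convergence of these powers passes to the forms.
variable (A) in
theorem wordForm_eq_sum (n : ℕ) (X : Matrix (Fin χ) (Fin χ) ℂ) :
    (wordForm A n X : ℂ) = ∑ p : Fin χ × Fin χ, ∑ q : Fin χ × Fin χ,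
      X p.1 p.2 * star (X q.1 q.2) *
        (transferMap A ^ n) (Matrix.single p.1 q.1 1 : Matrix (Fin χ) (Fin χ) ℂ) p.2 q.2 := by
  have h : ∀ w, ((‖(X * block A n w).trace‖ ^ 2 : ℝ) : ℂ) = ∑ p : Fin χ × Fin χ,
      ∑ q : Fin χ × Fin χ, X p.1 p.2 * star (X q.1 q.2) *
        (block A n w p.2 p.1 * star (block A n w q.2 q.1)) := by
    intro w
    have h1 : (X * block A n w).trace
        = ∑ p : Fin χ × Fin χ, X p.1 p.2 * block A n w p.2 p.1 := by
      simp [Matrix.trace, Matrix.mul_apply, Fintype.sum_prod_type]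
    rw [Complex.ofReal_pow, ← Complex.mul_conj', h1, map_sum, Finset.sum_mul_sum]
    refine Finset.sum_congr rfl fun p _ => Finset.sum_congr rfl fun q _ => ?_
    rw [map_mul]
    exact mul_mul_mul_comm _ _ _ _
  rw [wordForm, Complex.ofReal_sum]
  simp only [h, transferMap_pow_single, Finset.mul_sum]
  rw [Finset.sum_comm]
  exact Finset.sum_congr rfl fun p _ => Finset.sum_comm

theorem vanishing_ne_bot_of_not_injective {R : Module.End ℂ (Matrix (Fin χ) (Fin χ) ℂ)}
    (hR : ∀ (f : Matrix (Fin χ) (Fin χ) ℂ →ₗ[ℂ] ℂ) (v : Matrix (Fin χ) (Fin χ) ℂ),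
      Tendsto (fun n : ℕ => f ((transferMap A ^ n) v)) atTop (𝓝 (f (R v))))
    (hinj : ∀ n, 0 < n → ¬ IsInjectiveTensor (block A n)) : vanishing A ≠ ⊥ := by
  have hentry : ∀ (M : Matrix (Fin χ) (Fin χ) ℂ) (b e : Fin χ),
      Tendsto (fun n : ℕ => (transferMap A ^ n) M b e) atTop (𝓝 (R M b e)) :=
    fun M b e => hR (Matrix.entryLinearMap ℂ ℂ b e) M
  -- Unit vectors in the kernels, taken as plain functions so that the sup norm is available.
  have hex : ∀ n : ℕ, ∃ x : Fin χ → Fin χ → ℂ, ‖x‖ = 1 ∧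
      wordForm A (n + 1) (Matrix.of x) = 0 := by
    intro n
    have h := hinj (n + 1) n.succ_pos
    simp only [IsInjectiveTensor, Function.Injective, not_forall] at h
    obtain ⟨X, Y, hXY, hne⟩ := h
    let y : Fin χ → Fin χ → ℂ := fun a b => X a b - Y a b
    have hy : y ≠ 0 := fun h0 => hne (by
      ext a b
      exact sub_eq_zero.1 (congrFun (congrFun h0 a) b))
    have hy' : ‖y‖ ≠ 0 := norm_ne_zero_iff.2 hy
    have h0 : wordForm A (n + 1) (X - Y) = 0 := by
      refine Finset.sum_eq_zero fun w _ => ?_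
      rw [sub_mul, Matrix.trace_sub, congrFun hXY w]
      simp
    refine ⟨((‖y‖⁻¹ : ℝ) : ℂ) • y, ?_, ?_⟩
    · rw [norm_smul]
      simp [hy']
    · have : Matrix.of (((‖y‖⁻¹ : ℝ) : ℂ) • y) = ((‖y‖⁻¹ : ℝ) : ℂ) • (X - Y) := rfl
      rw [this, wordForm_smul, h0, mul_zero]
  choose x hx1 hx0 using hex
  obtain ⟨z, hz, φ, hφ, hlim⟩ := (isCompact_sphere (0 : Fin χ → Fin χ → ℂ) 1).tendsto_subseq
    (x := x) (fun n => by simp [hx1])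
  -- The limit depends only on `z`: along the kernel vectors it is `0`, so it is also `0` along the
  -- constant sequence `z`.
  have hconv : ∀ (y : ℕ → Fin χ → Fin χ → ℂ) (m : ℕ → ℕ), Tendsto y atTop (𝓝 z) →
      Tendsto m atTop atTop → Tendsto (fun n => (wordForm A (m n) (Matrix.of (y n)) : ℂ)) atTop
        (𝓝 (∑ p : Fin χ × Fin χ, ∑ q : Fin χ × Fin χ, z p.1 p.2 * star (z q.1 q.2) *
          R (Matrix.single p.1 q.1 1) p.2 q.2)) := by
    intro y m hy hm
    simp only [wordForm_eq_sum]
    have hyab : ∀ a b, Tendsto (fun n => y n a b) atTop (𝓝 (z a b)) := fun a b =>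
      (tendsto_pi_nhds.1 (tendsto_pi_nhds.1 hy a) b)
    exact tendsto_finsetSum _ fun p _ => tendsto_finsetSum _ fun q _ =>
      ((hyab _ _).mul (hyab _ _).star).mul ((hentry _ _ _).comp hm)
  have h1 := hconv (x ∘ φ) (fun n => φ n + 1) hlim
    ((tendsto_add_atTop_nat 1).comp hφ.tendsto_atTop)
  have h2 := hconv (fun _ => z) id tendsto_const_nhds tendsto_id
  simp only [Function.comp_apply, hx0, Complex.ofReal_zero] at h1
  rw [tendsto_nhds_unique h1 tendsto_const_nhds] at h2
  intro hbot
  have hzmem : (Matrix.of z) ∈ vanishing A := by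
    have h3 := (Complex.continuous_re.tendsto 0).comp h2
    simpa [mem_vanishing, Function.comp_def] using h3
  rw [hbot, Submodule.mem_bot] at hzmem
  have hz0 : z = 0 := hzmem
  simp [hz0] at hz

/-- Each entry of a power of the transfer map is a sum of products of two block entries, bounded
through `2xy ≤ x² + y²` by the word forms of two matrix units. -/
theorem eq_zero_of_vanishing_eq_top {R : Module.End ℂ (Matrix (Fin χ) (Fin χ) ℂ)}
    (hR : ∀ (f : Matrix (Fin χ) (Fin χ) ℂ →ₗ[ℂ] ℂ) (v : Matrix (Fin χ) (Fin χ) ℂ),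
      Tendsto (fun n : ℕ => f ((transferMap A ^ n) v)) atTop (𝓝 (f (R v))))
    (htop : vanishing A = ⊤) : R = 0 := by
  refine Matrix.ext_linearMap _ fun a c => LinearMap.ext_ring ?_
  ext b e
  refine tendsto_nhds_unique (hR (Matrix.entryLinearMap ℂ ℂ b e) (Matrix.single a c 1)) ?_
  have hv : ∀ X, Tendsto (fun n => wordForm A n X) atTop (𝓝 0) := fun X =>
    mem_vanishing.1 (by rw [htop]; trivial)
  have h := (hv (Matrix.single a b 1)).add (hv (Matrix.single c e 1))
  rw [add_zero] at h
  refine squeeze_zero_norm (fun n => ?_) h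
  rw [Matrix.entryLinearMap_apply, transferMap_pow_single, wordForm, wordForm,
    ← Finset.sum_add_distrib]
  refine (norm_sum_le _ _).trans (Finset.sum_le_sum fun w _ => ?_)
  simp only [norm_mul, norm_star, Matrix.trace_single_mul, one_smul]
  nlinarith [sq_nonneg (‖block A n w b a‖ - ‖block A n w e c‖), sq_nonneg ‖block A n w b a‖,
    sq_nonneg ‖block A n w e c‖]

theorem IsNormalTensor.bond_pos (hA : IsNormalTensor A) : 0 < χ := by
  by_contra! h0
  obtain rfl : χ = 0 := by omega
  have h := hA.peripheral
  have h1 : (1 : ℂ) ∈ ({1} : Multiset ℂ) := by simp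
  rw [← h, Multiset.mem_filter] at h1
  have h2 := Polynomial.isRoot_of_mem_roots h1.1
  rw [← Module.End.hasEigenvalue_iff_isRoot_charpoly] at h2
  obtain ⟨v, hv⟩ := h2.exists_hasEigenvector
  exact hv.2 (Subsingleton.elim _ _)

theorem exists_isInjectiveTensor_block (hA : IsNormalTensor A) :
    ∃ n, 0 < n ∧ IsInjectiveTensor (block A n) := by
  by_contra! hinj
  have hχ := hA.bond_pos
  obtain ⟨R, hR0, hR⟩ := exists_tendsto_pow_of_peripheral (transferMap A) hA.peripheral
  have htop : vanishing A = ⊤ := eq_top_of_ne_bot_of_two_sided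
    (mul_mul_mem_of_adjoin_eq_top (fun i X hX => mul_mem_vanishing hX i)
      (fun i X hX => mul_mem_vanishing' hX i)
      (adjoin_eq_top_of_irreducible hχ hA.irreducible))
    (vanishing_ne_bot_of_not_injective hR hinj)
  exact hR0 (eq_zero_of_vanishing_eq_top hR htop)

end Wielandt

/-! ### Spans of blocks -/

section Span

variable {d χ : ℕ} {A : Fin d → Matrix (Fin χ) (Fin χ) ℂ}

theorem span_range_block (n : ℕ) :
    Submodule.span ℂ (Set.range (block A n)) = Submodule.span ℂ (Set.range A) ^ n := by
  induction n with
  | zero =>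
    rw [pow_zero, Submodule.one_eq_span]
    congr 1
    ext M
    simp [block, eq_comm]
  | succ n ih =>
    rw [pow_succ', ← ih, Submodule.span_mul_span]
    congr 1
    ext M
    simp only [Set.mem_range, Set.mem_mul, exists_exists_eq_and]
    constructor
    · rintro ⟨w, rfl⟩
      exact ⟨w 0, Fin.tail w, by rw [← block_cons, Fin.cons_self_tail]⟩
    · rintro ⟨i, w, rfl⟩
      exact ⟨Fin.cons i w, block_cons A n i w⟩

/-- Every linear functional on matrices is a trace pairing with some `X`; one that kills the span
puts `X` in the kernel of the injective map. -/
theorem span_range_eq_top_of_isInjectiveTensor {ι : Type} {B : ι → Matrix (Fin χ) (Fin χ) ℂ}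
    (h : IsInjectiveTensor B) : Submodule.span ℂ (Set.range B) = ⊤ := by
  by_contra hne
  obtain ⟨f, hf, hle⟩ := Submodule.exists_le_ker_of_lt_top _ (lt_top_iff_ne_top.2 hne)
  let X : Matrix (Fin χ) (Fin χ) ℂ := Matrix.of fun a b => f (Matrix.single b a 1)
  have hX : ∀ M, (X * M).trace = f M := by
    intro M
    conv_rhs => rw [Matrix.matrix_eq_sum_single M]
    simp only [Matrix.trace, Matrix.diag, Matrix.mul_apply, map_sum]
    rw [Finset.sum_comm]
    refine Finset.sum_congr rfl fun i _ => Finset.sum_congr rfl fun j _ => ?_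
    have : Matrix.single i j (M i j) = M i j • Matrix.single i j (1 : ℂ) := by simp
    rw [this, map_smul, smul_eq_mul, mul_comm]
    rfl
  have hX0 : X = 0 := h (by
    funext i
    change (X * B i).trace = (0 * B i).trace
    rw [hX, zero_mul, Matrix.trace_zero]
    exact hle (Submodule.subset_span ⟨i, rfl⟩))
  refine hf (LinearMap.ext fun M => ?_)
  rw [← hX, hX0, zero_mul, Matrix.trace_zero, LinearMap.zero_apply]

theorem pow_eq_top_of_le {S : Submodule ℂ (Matrix (Fin χ) (Fin χ) ℂ)} {L n : ℕ} (hL : 0 < L)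
    (hS : S ^ L = ⊤) (hn : L ≤ n) : S ^ n = ⊤ := by
  induction n, hn using Nat.le_induction with
  | base => exact hS
  | succ n hn ih =>
    have h : S * ⊤ = ⊤ := by
      rw [eq_top_iff]
      calc ⊤ = S * S ^ (L - 1) := by rw [← pow_succ', Nat.sub_add_cancel hL, hS]
        _ ≤ S * ⊤ := by gcongr; exact le_top
    rw [pow_succ', ih, h]

/-- Otherwise `S ^ (t * L)` would lie on the line through `Y ^ L`, whereas it is the whole space, of
dimension `χ² ≥ 4`. -/
theorem not_pow_le_span_singleton {S : Submodule ℂ (Matrix (Fin χ) (Fin χ) ℂ)} {L t : ℕ}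
    (hχ : 2 ≤ χ) (hL : 0 < L) (hS : S ^ L = ⊤) (ht : 0 < t) (Y : Matrix (Fin χ) (Fin χ) ℂ) :
    ¬ S ^ t ≤ Submodule.span ℂ {Y} := by
  intro h
  have h1 : (⊤ : Submodule ℂ (Matrix (Fin χ) (Fin χ) ℂ)) ≤ Submodule.span ℂ {Y ^ L} := by
    rw [← pow_eq_top_of_le hL hS (Nat.le_mul_of_pos_left L ht), pow_mul]
    calc (S ^ t) ^ L ≤ Submodule.span ℂ {Y} ^ L := by gcongr
      _ = Submodule.span ℂ {Y ^ L} := by rw [Submodule.span_pow, Set.singleton_pow]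
  have h2 := Submodule.finrank_mono h1
  have h3 : Module.finrank ℂ (Submodule.span ℂ {Y ^ L}) ≤ 1 := by
    simpa using finrank_span_le_card (R := ℂ) ({Y ^ L} : Set (Matrix (Fin χ) (Fin χ) ℂ))
  rw [finrank_top, Module.finrank_matrix] at h2
  simp at h2
  nlinarith

/-- A subspace of matrices which is not contained in a line surjects onto `ℂ²` by evaluating two
suitable entries. -/
theorem exists_dual_entries {S : Submodule ℂ (Matrix (Fin χ) (Fin χ) ℂ)}
    (hS : ∀ Y, ¬ S ≤ Submodule.span ℂ {Y}) :
    ∃ (e : Fin 2 → Fin χ × Fin χ) (Y : Fin 2 → Matrix (Fin χ) (Fin χ) ℂ),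
      (∀ j, Y j ∈ S) ∧ ∀ j k, Y k (e j).1 (e j).2 = if j = k then 1 else 0 := by
  have hentry : ∀ Z : Matrix (Fin χ) (Fin χ) ℂ, Z ≠ 0 → ∃ a b, Z a b ≠ 0 := by
    intro Z hZ
    by_contra! hc
    exact hZ (by ext a b; exact hc a b)
  obtain ⟨Y₀, hY₀, hY₀'⟩ := SetLike.not_le_iff_exists.1 (hS 0)
  obtain ⟨a, b, hab⟩ := hentry Y₀ (fun h => hY₀' (by simp [h]))
  obtain ⟨Y₁, hY₁, hY₁'⟩ := SetLike.not_le_iff_exists.1 (hS Y₀)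
  let Z₁ := Y₁ - (Y₁ a b / Y₀ a b) • Y₀
  have hZ₁ : Z₁ ∈ S := S.sub_mem hY₁ (S.smul_mem _ hY₀)
  have hZ₁ab : Z₁ a b = 0 := by simp [Z₁, hab]
  obtain ⟨a', b', hab'⟩ := hentry Z₁ (fun h => hY₁' (by
    rw [sub_eq_zero.1 h]
    exact Submodule.smul_mem _ _ (Submodule.mem_span_singleton_self _)))
  let Z₀ := Y₀ - (Y₀ a' b' / Z₁ a' b') • Z₁
  have hZ₀ : Z₀ ∈ S := S.sub_mem hY₀ (S.smul_mem _ hZ₁)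
  have hZ₀ab : Z₀ a b = Y₀ a b := by simp [Z₀, hZ₁ab]
  have hZ₀ab' : Z₀ a' b' = 0 := by simp [Z₀, hab']
  refine ⟨![(a, b), (a', b')], ![(Y₀ a b)⁻¹ • Z₀, (Z₁ a' b')⁻¹ • Z₁], ?_, ?_⟩
  · intro j
    fin_cases j
    · exact S.smul_mem _ hZ₀
    · exact S.smul_mem _ hZ₁
  · intro j k
    fin_cases j <;> fin_cases k <;> simp [hZ₁ab, hZ₀ab, hZ₀ab', hab, hab']

end Span

/-! ### Schmidt rank -/

section Rank

/-- The scalar products of functions of the coordinates in `S` with functions of the other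
coordinates factor through sums over the coordinates in `S` and over the other ones. -/
theorem exists_sum_mul_factor {ι κ : Type*} [Fintype ι] [DecidableEq ι] [Fintype κ] (S : Set ι) :
    ∃ (u v : ((ι → κ) → ℂ) → ℂ), ∀ F G : (ι → κ) → ℂ, DependsOn F S → DependsOn G Sᶜ →
      ∑ i, F i * G i = u F * v G := by
  classical
  rcases isEmpty_or_nonempty (ι → κ) with h | ⟨⟨i₀⟩⟩
  · exact ⟨0, 0, by simp⟩
  let e := Equiv.piEquivPiSubtypeProd (· ∈ S) (fun _ => κ)
  refine ⟨fun F => ∑ x, F (e.symm (x, (e i₀).2)), fun G => ∑ y, G (e.symm ((e i₀).1, y)), ?_⟩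
  intro F G hF hG
  rw [Finset.sum_mul_sum, ← e.symm.sum_comp, Fintype.sum_prod_type]
  refine Finset.sum_congr rfl fun x _ => Finset.sum_congr rfl fun y _ => ?_
  congr 1
  · exact hF fun i hi => by simp [e, Equiv.piEquivPiSubtypeProd, hi]
  · exact hG fun i hi => by
      have : i ∉ S := hi
      simp [e, Equiv.piEquivPiSubtypeProd, this]

/-- The identity matrix of size `s` factors through `ℂ^r`. -/
theorem card_le_of_sum_mul_eq {s r : Type*} [Fintype s] [DecidableEq s] [Fintype r]
    (u v : s → r → ℂ) (h : ∀ j k, ∑ β, u j β * v k β = if j = k then 1 else 0) :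
    Fintype.card s ≤ Fintype.card r := by
  have hM : Matrix.of u * (Matrix.of v).transpose = 1 := by
    ext j k
    rw [Matrix.mul_apply, Matrix.one_apply, ← h]
    rfl
  calc Fintype.card s = (1 : Matrix s s ℂ).rank := by rw [Matrix.rank_one]
    _ ≤ (Matrix.of u).rank := by rw [← hM]; exact Matrix.rank_mul_le_left _ _
    _ ≤ Fintype.card r := Matrix.rank_le_card_width _

/-- Biorthogonal local weights on the two sides of a cut certify a lower bound for the Schmidt rank.
-/
theorem card_le_of_dual_weights {ι κ s r : Type*} [Fintype ι] [DecidableEq ι] [Fintype κ]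
    [Fintype s] [DecidableEq s] [Fintype r] (S : Set ι) {ψ : (ι → κ) → ℂ}
    {f g : r → (ι → κ) → ℂ} (hψ : ∀ i, ψ i = ∑ β, f β i * g β i)
    (hf : ∀ β, DependsOn (f β) S) (hg : ∀ β, DependsOn (g β) Sᶜ)
    (a b : s → (ι → κ) → ℂ) (ha : ∀ j, DependsOn (a j) S) (hb : ∀ j, DependsOn (b j) Sᶜ)
    (h : ∀ j k, ∑ i, a j i * b k i * ψ i = if j = k then 1 else 0) :
    Fintype.card s ≤ Fintype.card r := by
  obtain ⟨u, v, huv⟩ := exists_sum_mul_factor (κ := κ) S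
  refine card_le_of_sum_mul_eq (fun j β => u fun i => a j i * f β i)
    (fun k β => v fun i => b k i * g β i) fun j k => ?_
  rw [← h]
  simp only [hψ, Finset.mul_sum]
  rw [Finset.sum_comm]
  refine Finset.sum_congr rfl fun β _ => ?_
  rw [← huv _ _ (fun x y hxy => by simp only [ha j hxy, hf β hxy])
    (fun x y hxy => by simp only [hb k hxy, hg β hxy])]
  exact Finset.sum_congr rfl fun i _ => by ring

/-- Cutting bond `c` and fixing its index to `β` separates the sum over bond indices into a left and
a right factor. -/
theorem openMPS_eq_sum {N d : ℕ} (b : Fin (N + 1) → ℕ)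
    (A : (n : Fin N) → Fin d → Matrix (Fin (b n.castSucc)) (Fin (b n.succ)) ℂ)
    (c : Fin (N + 1)) :
    ∃ f g : Fin (b c) → (Fin N → Fin d) → ℂ, (∀ i, openMPS b A i = ∑ β, f β i * g β i) ∧
      (∀ β, DependsOn (f β) {n | n.castSucc < c}) ∧
      (∀ β, DependsOn (g β) {n | n.castSucc < c}ᶜ) := by
  classical
  let e := Equiv.piEquivPiSubtypeProd (· ≤ c) (fun n => Fin (b n))
  by_cases hne : Nonempty ((n : Fin (N + 1)) → Fin (b n))
  swap
  · refine ⟨0, 0, fun i => ?_, fun β _ _ _ => rfl, fun β _ _ _ => rfl⟩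
    have := not_nonempty_iff.1 hne
    simp [openMPS]
  obtain ⟨α₀⟩ := hne
  let F : (i : Fin N → Fin d) → ((n : Fin (N + 1)) → Fin (b n)) → ℂ := fun i α =>
    ∏ n : Fin N, if n.castSucc < c then A n (i n) (α n.castSucc) (α n.succ) else 1
  let G : (i : Fin N → Fin d) → ((n : Fin (N + 1)) → Fin (b n)) → ℂ := fun i α =>
    ∏ n : Fin N, if n.castSucc < c then 1 else A n (i n) (α n.castSucc) (α n.succ)
  -- `α₀` only fills bond indices that the factor does not read; the right factor does read bond
  -- `c`, hence the update to `β`.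
  refine ⟨fun β i => ∑ x with x ⟨c, le_rfl⟩ = β, F i (e.symm (x, (e α₀).2)),
    fun β i => ∑ y, G i (e.symm ((e (Function.update α₀ c β)).1, y)), fun i => ?_, ?_, ?_⟩
  · have h1 : openMPS b A i = ∑ x, ∑ y, F i (e.symm (x, y)) * G i (e.symm (x, y)) := by
      rw [← Fintype.sum_prod_type' (f := fun x y => F i (e.symm (x, y)) * G i (e.symm (x, y))),
        e.symm.sum_comp (fun α => F i α * G i α)]
      simp only [F, G, ← Finset.prod_mul_distrib]
      refine Finset.sum_congr rfl fun α _ => Finset.prod_congr rfl fun n _ => ?_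
      split_ifs <;> simp
    have hF : ∀ x y, F i (e.symm (x, y)) = F i (e.symm (x, (e α₀).2)) := by
      intro x y
      refine Finset.prod_congr rfl fun n _ => ?_
      split_ifs with hn
      · have h1 : n.castSucc ≤ c := hn.le
        have h2 : n.succ ≤ c := Fin.castSucc_lt_iff_succ_le.1 hn
        simp [e, Equiv.piEquivPiSubtypeProd, h1, h2]
      · rfl
    have hG : ∀ x y, G i (e.symm (x, y))
        = G i (e.symm ((e (Function.update α₀ c (x ⟨c, le_rfl⟩))).1, y)) := by
      intro x y
      refine Finset.prod_congr rfl fun n _ => ?_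
      split_ifs with hn
      · rfl
      · have key : ∀ m, c ≤ m → e.symm (x, y) m
            = e.symm ((e (Function.update α₀ c (x ⟨c, le_rfl⟩))).1, y) m := by
          intro m hm
          by_cases hmc : m ≤ c
          · obtain rfl : c = m := le_antisymm hm hmc
            simp [e, Equiv.piEquivPiSubtypeProd]
          · simp [e, Equiv.piEquivPiSubtypeProd, hmc]
        rw [key _ (not_lt.1 hn), key _ ((not_lt.1 hn).trans (Fin.castSucc_le_succ n))]
    rw [h1, ← Finset.sum_fiberwise (s := Finset.univ)
      (g := fun x : ((n : {n // n ≤ c}) → Fin (b n)) => x ⟨c, le_rfl⟩)]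
    refine Finset.sum_congr rfl fun β _ => ?_
    rw [Finset.sum_mul]
    refine Finset.sum_congr rfl fun x hx => ?_
    rw [Finset.mem_filter] at hx
    rw [Finset.mul_sum]
    refine Finset.sum_congr rfl fun y _ => ?_
    rw [hF, hG, hx.2]
  · intro β i i' hi
    refine Finset.sum_congr rfl fun x _ => Finset.prod_congr rfl fun n _ => ?_
    split_ifs with hn
    · rw [hi n hn]
    · rfl
  · intro β i i' hi
    refine Finset.sum_congr rfl fun y _ => Finset.prod_congr rfl fun n _ => ?_
    split_ifs with hn
    · rfl
    · rw [hi n hn]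

/-- The Schmidt rank of an MPS-up across every bipartition is at most the bond dimension. -/
theorem IsMPSUp.exists_schmidt {N d D : ℕ} {ψ : State N d} (h : IsMPSUp 0 D ψ)
    (S : Set (Fin N)) :
    ∃ r ≤ D, ∃ f g : Fin r → (Fin N → Fin d) → ℂ, (∀ i, ψ i = ∑ β, f β i * g β i) ∧
      (∀ β, DependsOn (f β) S) ∧ (∀ β, DependsOn (g β) Sᶜ) := by
  classical
  -- A permutation carries `S` to the first `|S|` sites, where the cut at bond `|S|` separates it
  -- from its complement.
  let c : Fin (N + 1) := ⟨Fintype.card S, by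
    have := Fintype.card_subtype_le (· ∈ S)
    rw [Fintype.card_fin] at this
    exact Nat.lt_succ_of_le this⟩
  have hcard : Fintype.card {n // n ∈ S} = Fintype.card {n : Fin N // n.castSucc < c} := by
    have hc : Fintype.card S ≤ N := Nat.le_of_lt_succ c.2
    rw [Fintype.card_subtype (fun n : Fin N => n.castSucc < c)]
    simp only [Fin.lt_def, Fin.val_castSucc, c]
    rw [Fin.card_filter_val_lt, min_eq_right hc]
  let e := Fintype.equivOfCardEq hcard
  let π := e.extendSubtype
  have hπ : ∀ n, (π n).castSucc < c ↔ n ∈ S := by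
    intro n
    by_cases hn : n ∈ S
    · exact iff_of_true (e.extendSubtype_mem n hn) hn
    · exact iff_of_false (e.extendSubtype_not_mem n hn) hn
  obtain ⟨b, A, -, -, hb, hA⟩ := h π
  have hA' : permuteSites π ψ = openMPS b A := sub_eq_zero.1 (norm_le_zero_iff.1 hA)
  obtain ⟨f, g, hfg, hf, hg⟩ := openMPS_eq_sum b A c
  refine ⟨b c, hb c, fun β i => f β (i ∘ π.symm), fun β i => g β (i ∘ π.symm), ?_, ?_, ?_⟩
  · intro i
    rw [← hfg, ← hA']
    simp [permuteSites, Function.comp_assoc]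
  · intro β i i' hi
    refine hf β fun n hn => hi _ ?_
    rw [← hπ, Equiv.apply_symm_apply]
    exact hn
  · intro β i i' hi
    refine hg β fun n hn => hi _ ?_
    rw [Set.mem_compl_iff, ← hπ, Equiv.apply_symm_apply]
    exact hn

end Rank

/-! ### The alternating bipartition -/

/-- The letters of the `k`-th of `Q` blocks of length `L`, in a word of length `Q * L + t`. -/
def subword {d Q L t : ℕ} (i : Fin (Q * L + t) → Fin d) (k : Fin Q) : Fin L → Fin d :=
  fun j => i (Fin.castAdd t (finProdFinEquiv (k, j)))

/-- The last `t` letters of a word of length `Q * L + t`. -/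
def tailword {d Q L t : ℕ} (i : Fin (Q * L + t) → Fin d) : Fin t → Fin d :=
  fun j => i (Fin.natAdd (Q * L) j)

theorem block_eq_prod_subwords {d χ Q L t : ℕ} (A : Fin d → Matrix (Fin χ) (Fin χ) ℂ)
    (i : Fin (Q * L + t) → Fin d) :
    block A (Q * L + t) i
      = (List.ofFn fun k : Fin Q => block A L (subword i k)).prod * block A t (tailword i) := by
  rw [block, List.ofFn_add, List.prod_append, List.ofFn_mul, List.prod_flatten, List.map_ofFn]
  congr 3
  funext k
  simp only [Function.comp_apply, block, subword]
  congr 2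
  funext j
  congr 2
  ext
  simp [finProdFinEquiv]
  ring

theorem sum_words_split {M : Type*} [AddCommMonoid M] {d Q L t : ℕ}
    (F : (Fin Q → Fin L → Fin d) → (Fin t → Fin d) → M) :
    ∑ i : Fin (Q * L + t) → Fin d, F (subword i) (tailword i) = ∑ u, ∑ v, F u v := by
  let e : (Fin (Q * L + t) → Fin d) ≃ (Fin Q → Fin L → Fin d) × (Fin t → Fin d) :=
    (Fin.appendEquiv (Q * L) t).symm.trans (Equiv.prodCongr
      ((Equiv.arrowCongr finProdFinEquiv.symm (Equiv.refl _)).trans (Equiv.curry _ _ _))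
      (Equiv.refl _))
  rw [← Fintype.sum_prod_type', ← e.sum_comp]
  rfl

theorem sum_smul_prod_ofFn {R : Type*} [Ring R] [Algebra ℂ R] {W : Type*} [Fintype W] {Q : ℕ}
    (c : Fin Q → W → ℂ) (M : W → R) :
    ∑ u : Fin Q → W, (∏ k, c k (u k)) • (List.ofFn fun k => M (u k)).prod
      = (List.ofFn fun k => ∑ w, c k w • M w).prod := by
  classical
  have h := (MultilinearMap.mkPiAlgebraFin ℂ Q R).map_sum (fun k w => c k w • M w)
  simp only [MultilinearMap.mkPiAlgebraFin_apply] at h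
  rw [h]
  refine Finset.sum_congr rfl fun u _ => ?_
  have h2 := (MultilinearMap.mkPiAlgebraFin ℂ Q R).map_smul_univ (fun k => c k (u k))
    (fun k => M (u k))
  simpa only [MultilinearMap.mkPiAlgebraFin_apply] using h2.symm

/-- Each inner bond joins a matrix unit of one family to one of the other, so the product survives
only if the two index sequences agree there. -/
theorem prod_alternating_single {χ : ℕ} (s s' : ℕ → Fin χ) (n : ℕ) :
    ((List.range (n + 1)).map fun k => if Even k then Matrix.single (s k) (s (k + 1)) (1 : ℂ)
        else Matrix.single (s' k) (s' (k + 1)) 1).prod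
      = if ∀ k, 1 ≤ k → k ≤ n → s k = s' k then
          Matrix.single (s 0) (if Even n then s (n + 1) else s' (n + 1)) 1 else 0 := by
  induction n with
  | zero =>
    rw [if_pos (fun k h1 h2 => by omega)]
    simp
  | succ n ih =>
    rw [List.prod_range_succ, ih]
    have hiff : (∀ k, 1 ≤ k → k ≤ n + 1 → s k = s' k) ↔
        (∀ k, 1 ≤ k → k ≤ n → s k = s' k) ∧ s (n + 1) = s' (n + 1) := by
      constructor
      · exact fun h => ⟨fun k h1 h2 => h k h1 (by omega), h _ (by omega) le_rfl⟩
      · rintro ⟨h, h'⟩ k h1 h2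
        rcases h2.lt_or_eq with h3 | rfl
        · exact h k h1 (by omega)
        · exact h'
    by_cases h : ∀ k, 1 ≤ k → k ≤ n → s k = s' k
    · rw [if_pos h]
      by_cases hs : s (n + 1) = s' (n + 1)
      · rw [if_pos (hiff.2 ⟨h, hs⟩)]
        by_cases hn : Even n
        · simp [hn, Nat.even_add_one, hs]
        · simp [hn, Nat.even_add_one, hs]
      · rw [if_neg (fun h' => hs (hiff.1 h').2)]
        by_cases hn : Even n
        · simp [hn, Nat.even_add_one, Matrix.single_mul_single_of_ne, hs]
        · simp [hn, Nat.even_add_one, Matrix.single_mul_single_of_ne, Ne.symm hs]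
    · rw [if_neg h, if_neg (fun h' => h (hiff.1 h').1), zero_mul]

/-- The bond indices `s 0, …, s (2 * m + 1)` with prescribed ends `p.2` and `p.1`. -/
def bondIndex {χ m : ℕ} (p : Fin χ × Fin χ) (σ : Fin (2 * m) → Fin χ) (k : ℕ) : Fin χ :=
  if h : 1 ≤ k ∧ k ≤ 2 * m then σ ⟨k - 1, by omega⟩ else if k = 0 then p.2 else p.1

theorem bondIndex_eq_iff {χ m : ℕ} (p p' : Fin χ × Fin χ) (σ σ' : Fin (2 * m) → Fin χ) :
    (∀ k, 1 ≤ k → k ≤ 2 * m → bondIndex p σ k = bondIndex p' σ' k) ↔ σ = σ' := by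
  constructor
  · intro h
    funext k
    have := h (k + 1) (by omega) (by omega)
    have hk : (k : ℕ) + 1 ≤ 2 * m := by omega
    simpa [bondIndex, hk] using this
  · rintro rfl k h1 h2
    simp [bondIndex, h1, h2]

/-- The weights are indexed by the `2 * m` inner bond indices and a tail label. Both parties see all
inner bonds, so pairing yields a delta in `σ`; the remaining matrix unit reads one entry of `Y`,
giving a delta in the label. -/
theorem bond_pow_mul_card_le {d χ L t m D : ℕ} {A : Fin d → Matrix (Fin χ) (Fin χ) ℂ}
    (hL : 0 < L) (hspan : Submodule.span ℂ (Set.range (block A L)) = ⊤)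
    (hup : IsMPSUp 0 D (tiMPS A ((2 * m + 1) * L + t))) {ι : Type*} [Fintype ι] [DecidableEq ι]
    (e : ι → Fin χ × Fin χ) (Y : ι → Matrix (Fin χ) (Fin χ) ℂ)
    (hY : ∀ j, Y j ∈ Submodule.span ℂ (Set.range (block A t)))
    (hYe : ∀ j k, Y k (e j).1 (e j).2 = if j = k then 1 else 0) :
    χ ^ (2 * m) * Fintype.card ι ≤ D := by
  have hc : ∀ X, ∃ c : (Fin L → Fin d) → ℂ, ∑ w, c w • block A L w = X := fun X =>
    (Submodule.mem_span_range_iff_exists_fun ℂ).1 (by rw [hspan]; trivial)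
  choose c hc using hc
  choose c' hc' using fun j => (Submodule.mem_span_range_iff_exists_fun ℂ).1 (hY j)
  -- The even blocks; the tail belongs to the complement.
  let S : Set (Fin ((2 * m + 1) * L + t)) := {n | n.val < (2 * m + 1) * L ∧ Even (n.val / L)}
  have hdiv : ∀ (k : Fin (2 * m + 1)) (j : Fin L),
      (Fin.castAdd t (finProdFinEquiv (k, j))).val / L = k := by
    intro k j
    simp [finProdFinEquiv, Nat.add_mul_div_left _ _ hL, Nat.div_eq_of_lt j.2]
  have hlt : ∀ (k : Fin (2 * m + 1)) (j : Fin L),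
      (Fin.castAdd t (finProdFinEquiv (k, j))).val < (2 * m + 1) * L := fun k j =>
    (finProdFinEquiv (k, j)).2
  obtain ⟨r, hr, f, g, hψ, hf, hg⟩ := hup.exists_schmidt S
  have hmain := card_le_of_dual_weights (s := ι × (Fin (2 * m) → Fin χ)) S hψ hf hg
    (fun p i => ∏ k : Fin (2 * m + 1), if Even k.val then
      c (Matrix.single (bondIndex (e p.1) p.2 k) (bondIndex (e p.1) p.2 (k + 1)) 1) (subword i k)
      else 1)
    (fun p i => (∏ k : Fin (2 * m + 1), if Even k.val then 1 else
      c (Matrix.single (bondIndex (e p.1) p.2 k) (bondIndex (e p.1) p.2 (k + 1)) 1) (subword i k))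
      * c' p.1 (tailword i)) ?_ ?_ ?_
  · rw [Fintype.card_prod, Fintype.card_fun, Fintype.card_fin, Fintype.card_fin,
      Fintype.card_fin, mul_comm] at hmain
    exact hmain.trans hr
  · intro p i i' hi
    refine Finset.prod_congr rfl fun k _ => ?_
    split_ifs with hk
    · congr 1
      funext j
      exact hi _ ⟨hlt k j, by rwa [hdiv]⟩
    · rfl
  · intro p i i' hi
    dsimp only
    congr 1
    · refine Finset.prod_congr rfl fun k _ => ?_
      split_ifs with hk
      · rfl
      · congr 1
        funext j
        refine hi _ fun h => hk ?_
        have := h.2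
        rwa [hdiv] at this
    · congr 1
      funext j
      refine hi _ fun h => ?_
      have := h.1
      simp at this
  · rintro ⟨j, σ⟩ ⟨j', σ'⟩
    let Z : ℕ → Matrix (Fin χ) (Fin χ) ℂ := fun k =>
      if Even k then Matrix.single (bondIndex (e j) σ k) (bondIndex (e j) σ (k + 1)) 1
      else Matrix.single (bondIndex (e j') σ' k) (bondIndex (e j') σ' (k + 1)) 1
    have h1 : ∀ i : Fin ((2 * m + 1) * L + t) → Fin d,
        (∏ k : Fin (2 * m + 1), if Even k.val then
          c (Matrix.single (bondIndex (e j) σ k) (bondIndex (e j) σ (k + 1)) 1) (subword i k)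
          else 1) * ((∏ k : Fin (2 * m + 1), if Even k.val then 1 else
          c (Matrix.single (bondIndex (e j') σ' k) (bondIndex (e j') σ' (k + 1)) 1)
            (subword i k)) * c' j' (tailword i)) * tiMPS A ((2 * m + 1) * L + t) i
        = (((∏ k : Fin (2 * m + 1), c (Z k) (subword i k)) •
            (List.ofFn fun k => block A L (subword i k)).prod) *
          (c' j' (tailword i) • block A t (tailword i))).trace := by
      intro i
      rw [← mul_assoc, ← Finset.prod_mul_distrib, smul_mul_smul_comm, Matrix.trace_smul,
        ← block_eq_prod_subwords, smul_eq_mul]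
      refine congrArg₂ (· * ·) (congrArg (· * _) ?_) rfl
      refine Finset.prod_congr rfl fun k _ => ?_
      simp only [Z]
      split_ifs <;> simp
    have h2 : ∑ i : Fin ((2 * m + 1) * L + t) → Fin d,
        (((∏ k : Fin (2 * m + 1), c (Z k) (subword i k)) •
            (List.ofFn fun k => block A L (subword i k)).prod) *
          (c' j' (tailword i) • block A t (tailword i))).trace
        = ((List.ofFn fun k : Fin (2 * m + 1) => Z k).prod * Y j').trace := by
      rw [sum_words_split (fun u v => (((∏ k : Fin (2 * m + 1), c (Z k) (u k)) •
            (List.ofFn fun k => block A L (u k)).prod) * (c' j' v • block A t v)).trace)]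
      simp only [← Matrix.trace_sum, ← Finset.mul_sum, ← Finset.sum_mul, hc']
      rw [sum_smul_prod_ofFn (fun k : Fin (2 * m + 1) => c (Z k)) (block A L)]
      simp only [hc]
    have h3 : (List.ofFn fun k : Fin (2 * m + 1) => Z k).prod
        = if σ = σ' then Matrix.single (e j).2 (e j).1 1 else 0 := by
      have hr : (List.ofFn fun k : Fin (2 * m + 1) => Z k) = (List.range (2 * m + 1)).map Z := by
        rw [← List.map_coe_finRange_eq_range, List.map_map, List.ofFn_eq_map]
        rfl
      rw [hr, prod_alternating_single, if_pos (even_two_mul m)]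
      simp only [bondIndex_eq_iff]
      simp [bondIndex]
    rw [Finset.sum_congr rfl fun i _ => h1 i, h2, h3]
    by_cases hσ : σ = σ'
    · simp [hσ, Matrix.trace_single_mul, hYe]
    · simp [hσ]

end MPSUp

/-! ### Counting -/

theorem proposition1 (d χ N D : ℕ) (A : Fin d → Matrix (Fin χ) (Fin χ) ℂ)
    (hA : MPSUp.IsNormalTensor A)
    (hup : MPSUp.IsMPSUp 0 D (MPSUp.tiMPS A N))
    (hN : (MPSUp.injectivityLength A : ℝ) * (Real.logb 2 (D : ℝ) + 1) < (N : ℝ)) :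
    ∃ φ : EuclideanSpace ℂ (Fin d), φ ≠ 0 ∧ MPSUp.tiMPS A N = MPSUp.productState φ N := by
  obtain ⟨hL, hinj⟩ : 0 < MPSUp.injectivityLength A ∧
      MPSUp.IsInjectiveTensor (MPSUp.block A (MPSUp.injectivityLength A)) :=
    Nat.sInf_mem (MPSUp.exists_isInjectiveTensor_block hA)
  generalize MPSUp.injectivityLength A = L at hL hinj hN
  have hspan := MPSUp.span_range_eq_top_of_isInjectiveTensor hinj
  have hpow := hspan
  rw [MPSUp.span_range_block] at hpow
  -- The boundary bond has dimension `1`.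
  have hD : 1 ≤ D := by
    obtain ⟨b, -, hb0, -, hb, -⟩ := hup 1
    rw [← hb0]
    exact hb 0
  have hlog : 0 ≤ Real.logb 2 (D : ℝ) :=
    Real.logb_nonneg one_lt_two (by exact_mod_cast hD)
  have hloglb : ∀ n : ℕ, 2 ^ n ≤ D → (n : ℝ) ≤ Real.logb 2 (D : ℝ) := by
    intro n hn
    rw [Real.le_logb_iff_rpow_le one_lt_two (by exact_mod_cast hD), Real.rpow_natCast]
    exact_mod_cast hn
  have hL' : (0 : ℝ) < L := by exact_mod_cast hL
  have hLN : L < N := by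
    have : (L : ℝ) < N := by nlinarith
    exact_mod_cast this
  rcases Nat.lt_trichotomy χ 1 with hχ | rfl | hχ
  · have := hA.bond_pos
    omega
  · refine ⟨WithLp.toLp 2 fun i => A i 0 0, fun h0 => ?_, ?_⟩
    · have hA0 : A = 0 := by
        funext i
        ext a b
        have := congrArg (fun φ : EuclideanSpace ℂ (Fin d) => φ i) h0
        rw [Subsingleton.elim a 0, Subsingleton.elim b 0]
        simpa using this
      have h10 : (1 : Matrix (Fin 1) (Fin 1) ℂ) = 0 := by
        refine hinj ?_
        funext w
        have : MPSUp.block A L w = 0 := by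
          simp [MPSUp.block, hA0, hL.ne']
        simp [this]
      exact one_ne_zero h10
    · ext i
      change (MPSUp.block A N i).trace = ∏ n, A (i n) 0 0
      -- In size one the trace is the determinant, which is multiplicative.
      have htr : ∀ M : Matrix (Fin 1) (Fin 1) ℂ, M.trace = M.det := fun M => by
        rw [Matrix.trace_fin_one, Matrix.det_fin_one]
      rw [htr, MPSUp.block, ← Matrix.coe_detMonoidHom, map_list_prod, List.map_ofFn,
        List.prod_ofFn]
      simp
  · exfalso
    obtain ⟨m, t, ht, ht', rfl⟩ : ∃ m t, 0 < t ∧ t ≤ 2 * L ∧ N = (2 * m + 1) * L + t := by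
      -- Dividing `N - L - 1` instead of `N - L` puts the tail length in `1, …, 2L`, so the tail is
      -- never empty.
      refine ⟨(N - L - 1) / (2 * L), (N - L - 1) % (2 * L) + 1, by omega, ?_, ?_⟩
      · have := Nat.mod_lt (N - L - 1) (show 0 < 2 * L by omega)
        omega
      · have := Nat.div_add_mod (N - L - 1) (2 * L)
        have h2 : (2 * ((N - L - 1) / (2 * L)) + 1) * L
            = 2 * L * ((N - L - 1) / (2 * L)) + L := by ring
        omega
    push_cast at hN
    -- A short tail has `N < (2m+2)L` and `D ≥ 2^(2m+1)`; a long one has `N ≤ (2m+3)L` and `D ≥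
    -- 2^(2m+2)`.
    rcases lt_or_ge t L with htL | htL
    · obtain ⟨e, Y, hY, hYe⟩ := MPSUp.exists_dual_entries
        (MPSUp.not_pow_le_span_singleton hχ hL hpow ht)
      rw [← MPSUp.span_range_block] at hY
      have h := MPSUp.bond_pow_mul_card_le hL hspan hup e Y hY hYe
      have h1 := hloglb (2 * m + 1) (by
        refine le_trans ?_ h
        rw [Fintype.card_fin, pow_succ]
        gcongr
        exact hχ)
      push_cast at h1
      have htL' : (t : ℝ) < L := by exact_mod_cast htL
      nlinarith
    · have h := MPSUp.bond_pow_mul_card_le (t := t) hL hspan hup id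
        (fun p : Fin χ × Fin χ => Matrix.single p.1 p.2 1)
        (fun p => by
          rw [MPSUp.span_range_block, MPSUp.pow_eq_top_of_le hL hpow htL]
          trivial)
        (fun p q => by
          simp [Matrix.single_apply, Prod.ext_iff, eq_comm])
      have h1 := hloglb (2 * m + 2) (by
        refine le_trans ?_ h
        rw [Fintype.card_prod, Fintype.card_fin, pow_add, pow_two 2]
        gcongr <;> exact hχ)
      push_cast at h1
      have htL' : (t : ℝ) ≤ 2 * L := by exact_mod_cast ht'
      nlinarith
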